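/- By a triangulation of a finite set $P$ of points in the plane, not all on one line, we mean a subdivision of the convex hull of $P$ into nondegenerate triangles, any two of which are disjoint or share exactly a common vertex or a common edge, such that the set of vertices of the triangles is exactly $P$; its edges are the sides of these triangles. A path $(v_1,\dots,v_t)$, $t\ge 1$, of vertices in which consecutive vertices are joined by edges is called monotone if there is a vector $\mathbf u\in\mathbb R^2\setminus\{\mathbf 0\}$ with $\langle \overrightarrow{v_iv_{i+1}},\mathbf u\rangle>0$ for $i=1,\dots,t-1$. Theorem. There is an absolute constant $C$ such that for every integer $n\ge 3$ there is a triangulation of some set of $n$ points in the plane that contains at most $C\, n^{2\log_2 3}\,(\log_2 n)^2$ monotone paths. Moreover $n^{2\log_2 3}(\log_2 n)^2=O(n^{3.17})$, so the number of monotone paths is $O(n^{3.17})$. -/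

import Mathlib

/-- The Euclidean plane. -/
abbrev Plane : Type := EuclideanSpace ℝ (Fin 2)

/-- A (straight-line) triangulation of a finite set `P` of points of the plane, not all on one line:
a geometric simplicial complex whose vertices are exactly the points of `P` and whose triangles,
edges and vertices together cover exactly the convex hull of `P`.
The requirement that `P` is not collinear excludes subdivided segments. -/
structure PlaneTriangulation (P : Finset Plane) where
  /-- the faces of the triangulation: its vertices, edges and triangles -/
  complex : Geometry.SimplicialComplex ℝ Plane
  not_collinear : ¬ Collinear ℝ (P : Set Plane)
  vertices_eq : complex.vertices = (P : Set Plane)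
  space_eq : complex.space = convexHull ℝ (P : Set Plane)

namespace PlaneTriangulation

/-- The plane straight-line graph of a triangulation: two distinct points are adjacent if and only
if the segment between them is an edge of the triangulation. -/
def graph {P : Finset Plane} (T : PlaneTriangulation P) : SimpleGraph Plane where
  Adj p q := p ≠ q ∧ ({p, q} : Finset Plane) ∈ T.complex.faces
  symm := ⟨fun p q h => ⟨h.1.symm, by rw [Finset.pair_comm]; exact h.2⟩⟩
  loopless := ⟨fun _ h => h.1 rfl⟩

/-- `l = (v₁, …, v_t)` is a path of the triangulation, given as the sequence of its vertices:
`t ≥ 1`, all `v_i` are vertices and any two consecutive ones are joined by an edge.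
(Distinctness of the vertices is automatic for monotone paths.) -/
def IsPath {P : Finset Plane} (T : PlaneTriangulation P) (l : List Plane) : Prop :=
  l ≠ [] ∧ (∀ p ∈ l, p ∈ P) ∧ l.IsChain T.graph.Adj

end PlaneTriangulation

/-- The polygonal path `(v₁, …, v_t)` is monotone in direction `u`: every directed edge has a
positive scalar product with `u`. -/
def IsMonotoneInDirection (u : Plane) (l : List Plane) : Prop :=
  l.IsChain (fun p q => 0 < inner ℝ (q - p) u)

/-- A polygonal path is monotone if it is monotone in some nonzero direction. -/
def IsMonotonePath (l : List Plane) : Prop :=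
  ∃ u : Plane, u ≠ 0 ∧ IsMonotoneInDirection u l

/-- The set of all monotone paths of a triangulation. Paths are directed here: a path with at least
two vertices and its reversal are two members of this set. -/
def PlaneTriangulation.monotonePaths {P : Finset Plane} (T : PlaneTriangulation P) :
    Set (List Plane) :=
  {l | T.IsPath l ∧ IsMonotonePath l}

/-! An explicit triangulation has only `O(n ^ 3)` monotone paths, and `3 ≤ 2 * logb 2 3`. Take two
hubs `(±3, 0)` and the chain `p_k = ((-1) ^ k, 4 ^ (-k))`. Each `p_(k+1)` is interior to the
triangle spanned by the hubs and `p_k`, so repeated stellar subdivision of the innermost triangle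
gives a triangulation in which chain points are joined only to the hubs and to their neighbours in
the chain (`exists_triangulation`).

A path monotone in direction `u` visits each hub at most once, and between hubs it runs through an
interval of the chain in one direction. There are `O(n ^ 2)` runs, but only `O(n)` of at most three
points. A longer run leading into a hub must follow increasing indices and forces `u 1 < 0`; a
longer run leaving a hub must follow decreasing indices and forces `0 < u 1`
(`neg_or_mem_runs_of_before_hub`, `pos_or_mem_runs_of_after_hub`). Hence the two runs around a
single hub are not both long, and a run between the two hubs is short. If both hubs are visited, the
runs before the first and after the second are not both nonempty (`not_height_lt_hubs`). Every path
thus consists of at most two nonempty runs, one of them short if there are two, which leaves `O(n ^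
3)` possibilities. -/

/-! ### Barycentric coordinates of finite sets. -/

theorem AffineIndependent.eqOn_of_sum_smul_eq {E : Type*} [AddCommGroup E] [Module ℝ E]
    {σ : Finset E} (hσ : AffineIndependent ℝ ((↑) : σ → E)) {f g : E → ℝ}
    (h1 : ∑ i ∈ σ, f i = ∑ i ∈ σ, g i) (h2 : ∑ i ∈ σ, f i • i = ∑ i ∈ σ, g i • i) :
    ∀ i ∈ σ, f i = g i := by
  intro i hi
  have := (affineIndependent_iff.1 hσ) Finset.univ (fun j => f j - g j)
    (by
      rw [Finset.sum_coe_sort σ (fun j => f j - g j), Finset.sum_sub_distrib, h1, sub_self])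
    (by
      rw [Finset.sum_coe_sort σ (fun j => (f j - g j) • j)]
      simp only [sub_smul]
      rw [Finset.sum_sub_distrib, h2, sub_self]) ⟨i, hi⟩ (Finset.mem_univ _)
  exact sub_eq_zero.1 this

theorem affineIndependent_finset_of_sum_smul {E : Type*} [AddCommGroup E] [Module ℝ E]
    {σ : Finset E} (h : ∀ f : E → ℝ, ∑ i ∈ σ, f i = 0 → ∑ i ∈ σ, f i • i = 0 → ∀ i ∈ σ, f i = 0) :
    AffineIndependent ℝ ((↑) : σ → E) := by
  classical
  rw [affineIndependent_iff]
  intro s w h1 h2 e he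
  let f : E → ℝ := fun x => if hx : x ∈ σ then (if (⟨x, hx⟩ : σ) ∈ s then w ⟨x, hx⟩ else 0) else 0
  have key : ∀ j : σ, f j = if j ∈ s then w j else 0 := fun j => by simp [f]
  have := h f
    (by
      rw [← Finset.sum_coe_sort σ f]
      simp only [key, Finset.sum_ite_mem, Finset.univ_inter, h1])
    (by
      rw [← Finset.sum_coe_sort σ (fun j => f j • j)]
      simp only [key, ite_smul, zero_smul, Finset.sum_ite_mem, Finset.univ_inter, h2]) e e.2
  simpa [key, he] using this

namespace Finset

variable {E : Type*} [AddCommGroup E] [Module ℝ E]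

theorem mem_convexHull_iff_of_subset {s σ : Finset E} (h : s ⊆ σ) {x : E} :
    x ∈ convexHull ℝ (s : Set E) ↔ ∃ μ : E → ℝ, (∀ i, 0 ≤ μ i) ∧ (∀ i ∉ s, μ i = 0) ∧
      ∑ i ∈ σ, μ i = 1 ∧ ∑ i ∈ σ, μ i • i = x := by
  classical
  rw [Finset.mem_convexHull']
  constructor
  · rintro ⟨w, h0, h1, h2⟩
    refine ⟨fun i => if i ∈ s then w i else 0, fun i => ?_, fun i hi => by simp [hi], ?_, ?_⟩
    · by_cases hi : i ∈ s <;> simp [hi, h0]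
    · rw [Finset.sum_ite_mem, Finset.inter_eq_right.2 h, h1]
    · simp only [ite_smul, zero_smul]
      rw [Finset.sum_ite_mem, Finset.inter_eq_right.2 h, h2]
  · rintro ⟨μ, h0, hs, h1, h2⟩
    refine ⟨μ, fun i _ => h0 i, ?_, ?_⟩
    · rw [← h1]
      exact Finset.sum_subset h fun i _ hi => hs i hi
    · rw [← h2]
      exact Finset.sum_subset h fun i _ hi => by rw [hs i hi, zero_smul]

theorem mem_convexHull_insert_iff_of_subset [DecidableEq E] {s σ : Finset E} (h : s ⊆ σ) {p : E}
    (hp : p ∉ σ) {x : E} :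
    x ∈ convexHull ℝ ((insert p s : Finset E) : Set E) ↔ ∃ (c : ℝ) (μ : E → ℝ), 0 ≤ c ∧
      (∀ i, 0 ≤ μ i) ∧ (∀ i ∉ s, μ i = 0) ∧
      c + ∑ i ∈ σ, μ i = 1 ∧ c • p + ∑ i ∈ σ, μ i • i = x := by
  rw [mem_convexHull_iff_of_subset (Finset.insert_subset_insert p h)]
  simp only [Finset.sum_insert hp]
  constructor
  · rintro ⟨μ, h0, hs, h1, h2⟩
    have e : ∀ i ∈ σ, (if i = p then 0 else μ i) = μ i := fun i hi =>
      if_neg (by rintro rfl; exact hp hi)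
    refine ⟨μ p, fun i => if i = p then 0 else μ i, h0 p, fun i => ?_, fun i hi => ?_, ?_, ?_⟩
    · dsimp only
      split_ifs
      exacts [le_rfl, h0 i]
    · dsimp only
      split_ifs with hip
      · rfl
      · exact hs i (by simp [hip, hi])
    · rw [Finset.sum_congr rfl e, h1]
    · rw [← h2]
      exact congrArg _ (Finset.sum_congr rfl fun i hi => congrArg (· • i) (e i hi))
  · rintro ⟨c, μ, hc, h0, hs, h1, h2⟩
    have e : ∀ i ∈ σ, (if i = p then c else μ i) = μ i := fun i hi =>
      if_neg (by rintro rfl; exact hp hi)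
    refine ⟨fun i => if i = p then c else μ i, fun i => ?_, fun i hi => ?_, ?_, ?_⟩
    · dsimp only
      split_ifs
      exacts [hc, h0 i]
    · rw [Finset.mem_insert, not_or] at hi
      simp [hi.1, hs i hi.2]
    · rw [Finset.sum_congr rfl e]
      simpa using h1
    · rw [Finset.sum_congr rfl fun i hi => congrArg (· • i) (e i hi)]
      simpa using h2

end Finset

/-! ### Stellar subdivision of a facet. -/

namespace Geometry.SimplicialComplex

variable {E : Type*} [AddCommGroup E] [Module ℝ E]

/-- The complex of all faces of a single simplex. -/
def ofSimplex (σ : Finset E) (hσ : AffineIndependent ℝ ((↑) : σ → E)) :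
    SimplicialComplex ℝ E where
  faces := {s | s ⊆ σ ∧ s.Nonempty}
  isRelLowerSet_faces := fun _ hs => ⟨hs.2, fun _ hts ht => ⟨hts.trans hs.1, ht⟩⟩
  indep := fun hs => hσ.mono (fun _ hx => hs.1 hx)
  inter_subset_convexHull := by
    intro s t hs ht
    exact (hσ.convexHull_inter hs.1 ht.1).ge

section stellar

variable {K : SimplicialComplex ℝ E} {σ : Finset E} {p : E} {w : E → ℝ}

/-- Coefficients with respect to a simplex coned off from a point of its interior. -/
theorem eq_add_of_cone_eq (hσ : AffineIndependent ℝ ((↑) : σ → E)) (hw1 : ∑ i ∈ σ, w i = 1)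
    (hwp : ∑ i ∈ σ, w i • i = p) {c d : ℝ} {μ ν : E → ℝ}
    (h1 : c + ∑ i ∈ σ, μ i = d + ∑ i ∈ σ, ν i)
    (h2 : c • p + ∑ i ∈ σ, μ i • i = d • p + ∑ i ∈ σ, ν i • i) :
    ∀ i ∈ σ, c * w i + μ i = d * w i + ν i := by
  apply hσ.eqOn_of_sum_smul_eq
  · rw [Finset.sum_add_distrib, Finset.sum_add_distrib, ← Finset.mul_sum, ← Finset.mul_sum, hw1,
      mul_one, mul_one, h1]
  · simp only [add_smul, mul_smul]
    rw [Finset.sum_add_distrib, Finset.sum_add_distrib, ← Finset.smul_sum, ← Finset.smul_sum, hwp,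
      h2]

theorem mem_convexHull_of_pos_weights (hw : ∀ i ∈ σ, 0 < w i) (hw1 : ∑ i ∈ σ, w i = 1)
    (hwp : ∑ i ∈ σ, w i • i = p) : p ∈ convexHull ℝ (σ : Set E) :=
  Finset.mem_convexHull'.2 ⟨w, fun i hi => (hw i hi).le, hw1, hwp⟩

variable [DecidableEq E]

/-- A vertex `j` of `σ` outside `s` has coordinate `f p * w j` in a relation on `insert p s`, so the
coefficient of `p` vanishes. -/
theorem affineIndependent_insert_of_ssubset (hσ : AffineIndependent ℝ ((↑) : σ → E)) (hp : p ∉ σ)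
    (hw : ∀ i ∈ σ, 0 < w i) (hw1 : ∑ i ∈ σ, w i = 1) (hwp : ∑ i ∈ σ, w i • i = p)
    {s : Finset E} (hs : s ⊂ σ) :
    AffineIndependent ℝ ((↑) : ↥(insert p s : Finset E) → E) := by
  apply affineIndependent_finset_of_sum_smul
  intro f h1 h2
  have hps : p ∉ s := fun h => hp (hs.1 h)
  rw [Finset.sum_insert hps] at h1 h2
  have key := eq_add_of_cone_eq hσ hw1 hwp (c := f p) (d := 0)
    (μ := fun i => if i ∈ s then f i else 0) (ν := 0)
    (by
      rw [Finset.sum_ite_mem, Finset.inter_eq_right.2 hs.1, h1]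
      simp)
    (by
      simp only [ite_smul, zero_smul]
      rw [Finset.sum_ite_mem, Finset.inter_eq_right.2 hs.1, h2]
      simp)
  obtain ⟨j, hjσ, hjs⟩ := Finset.exists_of_ssubset hs
  have hp0 : f p = 0 := by
    have := key j hjσ
    simp only [hjs, if_false, add_zero, zero_mul, Pi.zero_apply, mul_eq_zero] at this
    exact this.resolve_right (hw j hjσ).ne'
  intro i hi
  rcases Finset.mem_insert.1 hi with rfl | hi
  · exact hp0
  · simpa [hi, hp0] using key i (hs.1 hi)

/-- The coefficient of `p` is determined by the point: comparing coordinates at a vertex missing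
from `s` and at one missing from `t` gives both inequalities between `c` and `d`. The other
coefficients then agree too. -/
theorem cone_inter_cone_subset (hσ : AffineIndependent ℝ ((↑) : σ → E)) (hp : p ∉ σ)
    (hw : ∀ i ∈ σ, 0 < w i) (hw1 : ∑ i ∈ σ, w i = 1) (hwp : ∑ i ∈ σ, w i • i = p)
    {s t : Finset E} (hs : s ⊂ σ) (ht : t ⊂ σ) :
    convexHull ℝ ((insert p s : Finset E) : Set E) ∩ convexHull ℝ ((insert p t : Finset E) : Set E)
      ⊆ convexHull ℝ ((insert p (s ∩ t) : Finset E) : Set E) := by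
  rintro x ⟨hxs, hxt⟩
  rw [Finset.mem_convexHull_insert_iff_of_subset hs.1 hp] at hxs
  rw [Finset.mem_convexHull_insert_iff_of_subset ht.1 hp] at hxt
  obtain ⟨c, μ, hc, hμ, hμs, h1, h2⟩ := hxs
  obtain ⟨d, ν, hd, hν, hνt, h3, h4⟩ := hxt
  have key := eq_add_of_cone_eq hσ hw1 hwp (h1.trans h3.symm) (h2.trans h4.symm)
  obtain ⟨i, hiσ, his⟩ := Finset.exists_of_ssubset hs
  obtain ⟨j, hjσ, hjt⟩ := Finset.exists_of_ssubset ht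
  have hcd : c = d := by
    have hi := key i hiσ
    have hj := key j hjσ
    rw [hμs i his] at hi
    rw [hνt j hjt] at hj
    apply le_antisymm
    · exact le_of_mul_le_mul_right (by linarith [hμ j]) (hw j hjσ)
    · exact le_of_mul_le_mul_right (by linarith [hν i]) (hw i hiσ)
  subst hcd
  rw [Finset.mem_convexHull_insert_iff_of_subset (Finset.inter_subset_left.trans hs.1) hp]
  refine ⟨c, μ, hc, hμ, fun k hk => ?_, h1, h2⟩
  by_cases hks : k ∈ s
  · have hkt : k ∉ t := fun h => hk (Finset.mem_inter.2 ⟨hks, h⟩)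
    have := key k (hs.1 hks)
    rw [hνt k hkt] at this
    linarith
  · exact hμs k hks

/-- A common point lies in the face `σ ∩ t`, so its coordinate at a vertex of `σ` outside `t` is
zero. Since `p` has positive coordinate there, `p` does not contribute. -/
theorem cone_inter_convexHull_subset (hσ : σ ∈ K.facets) (hp : p ∉ σ)
    (hw : ∀ i ∈ σ, 0 < w i) (hw1 : ∑ i ∈ σ, w i = 1) (hwp : ∑ i ∈ σ, w i • i = p)
    {s t : Finset E} (hs : s ⊂ σ) (ht : t ∈ K.faces) (htσ : t ≠ σ) :
    convexHull ℝ ((insert p s : Finset E) : Set E) ∩ convexHull ℝ (t : Set E)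
      ⊆ convexHull ℝ ((s ∩ t : Finset E) : Set E) := by
  rintro x ⟨hxs, hxt⟩
  have hxσ : x ∈ convexHull ℝ (σ : Set E) := by
    refine convexHull_min ?_ (convex_convexHull ℝ _) hxs
    rw [Finset.coe_insert, Set.insert_subset_iff]
    exact ⟨mem_convexHull_of_pos_weights hw hw1 hwp,
      (Finset.coe_subset.2 hs.1).trans (subset_convexHull ℝ _)⟩
  have hxi := K.inter_subset_convexHull hσ.1 ht ⟨hxσ, hxt⟩
  rw [← Finset.coe_inter, Finset.mem_convexHull_iff_of_subset Finset.inter_subset_left] at hxi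
  obtain ⟨ν, -, hνt, h3, h4⟩ := hxi
  rw [Finset.mem_convexHull_insert_iff_of_subset hs.1 hp] at hxs
  obtain ⟨c, μ, hc, hμ, hμs, h1, h2⟩ := hxs
  have key := eq_add_of_cone_eq (K.indep hσ.1) hw1 hwp (c := c) (d := 0) (μ := μ) (ν := ν)
    (by rw [h1, h3, zero_add]) (by rw [h2, h4, zero_smul, zero_add])
  -- Maximality of the facet `σ` enters here.
  obtain ⟨j, hjσ, hjt⟩ : ∃ j ∈ σ, j ∉ t := by
    by_contra! h
    exact htσ (hσ.2 ht h).symm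
  have hc0 : c = 0 := by
    have hj := key j hjσ
    rw [hνt j (by simp [hjt]), zero_mul, zero_add] at hj
    have : c * w j ≤ 0 * w j := by linarith [hμ j]
    exact le_antisymm (le_of_mul_le_mul_right this (hw j hjσ)) hc
  subst hc0
  rw [zero_add] at h1
  rw [zero_smul, zero_add] at h2
  have hx : x ∈ convexHull ℝ (s : Set E) :=
    (Finset.mem_convexHull_iff_of_subset hs.1).2 ⟨μ, hμ, hμs, h1, h2⟩
  have hsn : s.Nonempty := by
    have : (s : Set E).Nonempty := convexHull_nonempty_iff.1 ⟨x, hx⟩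
    exact_mod_cast this
  rw [Finset.coe_inter]
  exact K.inter_subset_convexHull (K.down_closed hσ.1 hs.1 hsn) ht ⟨hx, hxt⟩

/-- Subdivision of a facet of a simplicial complex by coning off its proper faces from a point `p`
of its relative interior. -/
def stellarSubdivision (hσ : σ ∈ K.facets) (hp : p ∉ σ)
    (hw : ∀ i ∈ σ, 0 < w i) (hw1 : ∑ i ∈ σ, w i = 1) (hwp : ∑ i ∈ σ, w i • i = p) :
    SimplicialComplex ℝ E where
  faces := {t | (t ∈ K.faces ∧ t ≠ σ) ∨ ∃ s ⊂ σ, t = insert p s}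
  isRelLowerSet_faces := by
    rintro t (⟨ht, htσ⟩ | ⟨s, hs, rfl⟩)
    · refine ⟨K.nonempty_of_mem_faces ht, fun r hrt hr => Or.inl ⟨K.down_closed ht hrt hr, ?_⟩⟩
      rintro rfl
      exact htσ (hσ.2 ht hrt).symm
    · refine ⟨Finset.insert_nonempty _ _, fun r hrs hr => ?_⟩
      change r ⊆ insert p s at hrs
      by_cases hpr : p ∈ r
      · refine Or.inr ⟨r.erase p, ?_, (Finset.insert_erase hpr).symm⟩
        exact lt_of_le_of_lt (Finset.subset_insert_iff.1 hrs) hs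
      · have hrs' : r ⊆ s := (Finset.subset_insert_iff_of_notMem hpr).1 hrs
        have : r ⊂ σ := lt_of_le_of_lt hrs' hs
        exact Or.inl ⟨K.down_closed hσ.1 this.1 hr, this.ne⟩
  indep := by
    rintro t (⟨ht, -⟩ | ⟨s, hs, rfl⟩)
    · exact K.indep ht
    · exact affineIndependent_insert_of_ssubset (K.indep hσ.1) hp hw hw1 hwp hs
  inter_subset_convexHull := by
    rintro t t' (⟨ht, htσ⟩ | ⟨s, hs, rfl⟩) (⟨ht', htσ'⟩ | ⟨s', hs', rfl⟩)
    · exact K.inter_subset_convexHull ht ht'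
    · rw [Set.inter_comm, Set.inter_comm (t : Set E), ← Finset.coe_inter]
      exact (cone_inter_convexHull_subset hσ hp hw hw1 hwp hs' ht htσ).trans
        (convexHull_mono (Finset.coe_subset.2
          (Finset.inter_subset_inter_right (Finset.subset_insert _ _))))
    · rw [← Finset.coe_inter]
      exact (cone_inter_convexHull_subset hσ hp hw hw1 hwp hs ht' htσ').trans
        (convexHull_mono (Finset.coe_subset.2
          (Finset.inter_subset_inter_right (Finset.subset_insert _ _))))
    · rw [← Finset.coe_inter, ← Finset.insert_inter_distrib]
      exact cone_inter_cone_subset (K.indep hσ.1) hp hw hw1 hwp hs hs'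

variable (hσ : σ ∈ K.facets) (hp : p ∉ σ) (hw : ∀ i ∈ σ, 0 < w i) (hw1 : ∑ i ∈ σ, w i = 1)
  (hwp : ∑ i ∈ σ, w i • i = p)

theorem mem_stellarSubdivision_faces {t : Finset E} :
    t ∈ (stellarSubdivision hσ hp hw hw1 hwp).faces ↔
      (t ∈ K.faces ∧ t ≠ σ) ∨ ∃ s ⊂ σ, t = insert p s := Iff.rfl

/-- Subtract from `x` the largest multiple of `p` that keeps all coordinates nonnegative, namely the
minimum of `f i / w i`; the coordinate attaining it vanishes. -/
theorem convexHull_eq_biUnion_cone {x : E} (hp : p ∉ σ) (hw : ∀ i ∈ σ, 0 < w i)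
    (hw1 : ∑ i ∈ σ, w i = 1) (hwp : ∑ i ∈ σ, w i • i = p) (hx : x ∈ convexHull ℝ (σ : Set E)) :
    ∃ s ⊂ σ, x ∈ convexHull ℝ ((insert p s : Finset E) : Set E) := by
  rw [Finset.mem_convexHull_iff_of_subset subset_rfl] at hx
  obtain ⟨f, hf, hfσ, hf1, hfx⟩ := hx
  have hne : σ.Nonempty := by
    rw [Finset.nonempty_iff_ne_empty]
    rintro rfl
    simp at hf1
  obtain ⟨j, hj, hmin⟩ := Finset.exists_min_image σ (fun i => f i / w i) hne
  have hle : ∀ i ∈ σ, f j / w j * w i ≤ f i := fun i hi => (le_div_iff₀ (hw i hi)).1 (hmin i hi)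
  refine ⟨σ.erase j, Finset.erase_ssubset hj, ?_⟩
  rw [Finset.mem_convexHull_insert_iff_of_subset (Finset.erase_subset _ _) hp]
  refine ⟨f j / w j, fun i => if i ∈ σ then f i - f j / w j * w i else 0,
    div_nonneg (hf j) (hw j hj).le, fun i => ?_, fun i hi => ?_, ?_, ?_⟩
  · dsimp only
    split_ifs with h
    exacts [sub_nonneg.2 (hle i h), le_rfl]
  · by_cases hij : i = j
    · subst hij
      have := (hw i hj).ne'
      simp only [hj, if_true]
      field_simp
      ring
    · have : i ∉ σ := fun h => hi (Finset.mem_erase.2 ⟨hij, h⟩)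
      simp [this]
  · rw [Finset.sum_congr rfl fun i hi => if_pos hi, Finset.sum_sub_distrib, ← Finset.mul_sum, hw1,
      hf1]
    ring
  · rw [Finset.sum_congr rfl fun i hi => (congrArg (· • i) (if_pos hi)).trans
      ((sub_smul _ _ _).trans (congrArg _ (mul_smul _ _ _))),
      Finset.sum_sub_distrib, ← Finset.smul_sum, hwp, hfx]
    abel

theorem stellarSubdivision_space : (stellarSubdivision hσ hp hw hw1 hwp).space = K.space := by
  ext x
  simp only [mem_space_iff]
  constructor
  · rintro ⟨t, ⟨ht, -⟩ | ⟨s, hs, rfl⟩, hx⟩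
    · exact ⟨t, ht, hx⟩
    · refine ⟨σ, hσ.1, convexHull_min ?_ (convex_convexHull ℝ _) hx⟩
      rw [Finset.coe_insert, Set.insert_subset_iff]
      exact ⟨mem_convexHull_of_pos_weights hw hw1 hwp,
        (Finset.coe_subset.2 hs.1).trans (subset_convexHull ℝ _)⟩
  · rintro ⟨t, ht, hx⟩
    by_cases htσ : t = σ
    · subst htσ
      obtain ⟨s, hs, hxs⟩ := convexHull_eq_biUnion_cone hp hw hw1 hwp hx
      exact ⟨_, Or.inr ⟨s, hs, rfl⟩, hxs⟩
    · exact ⟨t, Or.inl ⟨ht, htσ⟩, hx⟩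

theorem stellarSubdivision_vertices (hcard : 1 < σ.card) :
    (stellarSubdivision hσ hp hw hw1 hwp).vertices = insert p K.vertices := by
  ext x
  simp only [mem_vertices, mem_stellarSubdivision_faces, Set.mem_insert_iff]
  constructor
  · rintro (⟨h, -⟩ | ⟨s, -, h⟩)
    · exact Or.inr h
    · left
      have : p ∈ ({x} : Finset E) := h ▸ Finset.mem_insert_self p s
      exact (Finset.mem_singleton.1 this).symm
  · rintro (rfl | h)
    · refine Or.inr ⟨∅, ?_, rfl⟩
      rw [Finset.empty_ssubset, ← Finset.card_pos]
      omega
    · refine Or.inl ⟨h, ?_⟩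
      rintro rfl
      simp at hcard

end stellar

end Geometry.SimplicialComplex

/-! ### The nested triangulation. -/

/-- Two hubs on a horizontal line, and a zigzag chain of points descending towards that line. -/
noncomputable def hubChainPoint : Bool ⊕ ℕ → Plane
  | Sum.inl s => !₂[if s then 3 else -3, 0]
  | Sum.inr k => !₂[(-1) ^ k, (1 / 4) ^ k]

namespace hubChainPoint

@[simp] theorem inl_zero (s : Bool) : hubChainPoint (Sum.inl s) 0 = if s then 3 else -3 := rfl
@[simp] theorem inl_one (s : Bool) : hubChainPoint (Sum.inl s) 1 = 0 := rfl
@[simp] theorem inr_zero (k : ℕ) : hubChainPoint (Sum.inr k) 0 = (-1) ^ k := rfl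
@[simp] theorem inr_one (k : ℕ) : hubChainPoint (Sum.inr k) 1 = (1 / 4) ^ k := rfl

theorem injective : Function.Injective hubChainPoint := by
  intro i j h
  have h0 := congrArg (fun x : Plane => x 0) h
  have h1 := congrArg (fun x : Plane => x 1) h
  rcases i with s | i <;> rcases j with t | j
  · cases s <;> cases t <;> simp at h0 ⊢ <;> norm_num at h0
  · exact absurd h1.symm (pow_pos (by norm_num : (0 : ℝ) < 1 / 4) j).ne'
  · exact absurd h1 (pow_pos (by norm_num : (0 : ℝ) < 1 / 4) i).ne'
  · exact congrArg Sum.inr (pow_right_injective₀ (by norm_num) (by norm_num) h1)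

/-- The triangle spanned by the two hubs and a point of the chain. -/
noncomputable def triangle (k : ℕ) : Finset Plane :=
  {hubChainPoint (Sum.inl false), hubChainPoint (Sum.inl true), hubChainPoint (Sum.inr k)}

theorem sum_triangle {M : Type*} [AddCommMonoid M] (f : Plane → M) (k : ℕ) :
    ∑ x ∈ triangle k, f x = f (hubChainPoint (Sum.inl false)) + (f (hubChainPoint (Sum.inl true))
      + f (hubChainPoint (Sum.inr k))) := by
  rw [triangle, Finset.sum_insert, Finset.sum_insert, Finset.sum_singleton] <;>
    simp [injective.eq_iff]

theorem card_triangle (k : ℕ) : (triangle k).card = 3 := by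
  rw [triangle, Finset.card_insert_of_notMem, Finset.card_insert_of_notMem,
    Finset.card_singleton] <;> simp [injective.eq_iff]

theorem mem_triangle {i : Bool ⊕ ℕ} {k : ℕ} :
    hubChainPoint i ∈ triangle k ↔ (∃ s, i = Sum.inl s) ∨ i = Sum.inr k := by
  simp only [triangle, Finset.mem_insert, Finset.mem_singleton, injective.eq_iff, Bool.exists_bool,
    or_assoc]

theorem affineIndependent_triangle (k : ℕ) :
    AffineIndependent ℝ ((↑) : triangle k → Plane) := by
  apply affineIndependent_finset_of_sum_smul
  intro f h1 h2
  rw [sum_triangle] at h1 h2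
  have e0 := congrArg (fun x : Plane => x 0) h2
  have e1 := congrArg (fun x : Plane => x 1) h2
  simp at e0 e1
  rw [e1] at h1 e0
  intro i hi
  simp only [triangle, Finset.mem_insert, Finset.mem_singleton] at hi
  rcases hi with rfl | rfl | rfl
  · linarith
  · linarith
  · exact e1

theorem exists_weights_triangle (k : ℕ) : ∃ w : Plane → ℝ, (∀ i ∈ triangle k, 0 < w i) ∧
    ∑ i ∈ triangle k, w i = 1 ∧ ∑ i ∈ triangle k, w i • i = hubChainPoint (Sum.inr (k + 1)) := by
  classical
  -- The second coordinate forces weight `1 / 4` on the chain point; the hubs share `3 / 4`, and the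
  -- first coordinate fixes their difference as `5 / 12 * (-1) ^ k`.
  refine ⟨fun x => if x = hubChainPoint (Sum.inl false) then 3 / 8 + 5 / 24 * (-1) ^ k else
    if x = hubChainPoint (Sum.inl true) then 3 / 8 - 5 / 24 * (-1) ^ k else 1 / 4, ?_, ?_, ?_⟩
  · intro i hi
    dsimp only
    rcases neg_one_pow_eq_or ℝ k with h | h <;> rw [h] <;> split_ifs <;> norm_num
  · rw [sum_triangle]
    simp only [injective.eq_iff, if_true, reduceCtorEq, if_false, Sum.inl.injEq, Bool.true_eq_false]
    ring
  · rw [sum_triangle]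
    simp only [injective.eq_iff, if_true, reduceCtorEq, if_false, Sum.inl.injEq, Bool.true_eq_false]
    ext j
    fin_cases j
    · simp [pow_succ]
      ring
    · simp [pow_succ]
      ring

/-- An upper bound for the adjacency of the nested triangulation. -/
def Adj : Bool ⊕ ℕ → Bool ⊕ ℕ → Prop
  | Sum.inr i, Sum.inr j => j = i + 1 ∨ i = j + 1
  | _, _ => True

theorem adj_symm {i j : Bool ⊕ ℕ} (h : Adj i j) : Adj j i := by
  rcases i with s | i <;> rcases j with t | j <;> simp only [Adj] at h ⊢
  exact h.symm

theorem adj_of_mem_triangle {j : Bool ⊕ ℕ} {k : ℕ} (h : hubChainPoint j ∈ triangle k) :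
    Adj (Sum.inr (k + 1)) j := by
  rcases mem_triangle.1 h with ⟨s, rfl⟩ | rfl <;> simp [Adj]

/-- Induction on `m`: keeping `triangle m` a facet allows the next point to be inserted there. Upper
bounds on paths need only one implication for adjacency. -/
theorem exists_complex (m : ℕ) : ∃ K : Geometry.SimplicialComplex ℝ Plane,
    triangle m ∈ K.facets ∧
    K.vertices = hubChainPoint '' {i | ∀ k, i = Sum.inr k → k ≤ m} ∧
    K.space = convexHull ℝ (triangle 0 : Set Plane) ∧
    ∀ i j, i ≠ j → {hubChainPoint i, hubChainPoint j} ∈ K.faces → Adj i j := by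
  classical
  induction m with
  | zero =>
    refine ⟨Geometry.SimplicialComplex.ofSimplex _ (affineIndependent_triangle 0), ?_, ?_, ?_, ?_⟩
    · exact ⟨⟨subset_rfl, _, Finset.mem_insert_self _ _⟩, fun t ht h => h.antisymm ht.1⟩
    · ext x
      constructor
      · rintro ⟨hx, -⟩
        rw [Finset.singleton_subset_iff] at hx
        simp only [triangle, Finset.mem_insert, Finset.mem_singleton] at hx
        rcases hx with rfl | rfl | rfl <;> exact ⟨_, by simp, rfl⟩
      · rintro ⟨i, hi, rfl⟩
        refine ⟨?_, Finset.singleton_nonempty _⟩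
        rw [Finset.singleton_subset_iff, mem_triangle]
        rcases i with s | k
        · exact Or.inl ⟨s, rfl⟩
        · right
          rw [Nat.le_zero.1 (hi k rfl)]
    · apply Set.Subset.antisymm
      · intro x hx
        obtain ⟨s, hs, hx⟩ := Geometry.SimplicialComplex.mem_space_iff.1 hx
        exact convexHull_mono (Finset.coe_subset.2 hs.1) hx
      · exact Geometry.SimplicialComplex.convexHull_subset_space
          ⟨subset_rfl, _, Finset.mem_insert_self _ _⟩
    · rintro i j hij ⟨h, -⟩
      rw [Finset.insert_subset_iff, Finset.singleton_subset_iff, mem_triangle, mem_triangle] at h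
      rcases h with ⟨⟨s, rfl⟩ | rfl, ⟨t, rfl⟩ | rfl⟩ <;> simp [Adj] at hij ⊢
  | succ m ih =>
    obtain ⟨K, hσ, hv, hs, hadj⟩ := ih
    obtain ⟨w, hw, hw1, hwp⟩ := exists_weights_triangle m
    have hp : hubChainPoint (Sum.inr (m + 1)) ∉ triangle m := by
      rw [mem_triangle]
      simp
    refine ⟨Geometry.SimplicialComplex.stellarSubdivision hσ hp hw hw1 hwp, ⟨?_, ?_⟩, ?_, ?_, ?_⟩
    · refine Or.inr ⟨{hubChainPoint (Sum.inl false), hubChainPoint (Sum.inl true)}, ?_, ?_⟩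
      · refine ⟨fun x hx => ?_, fun h => ?_⟩
        · simp only [Finset.mem_insert, Finset.mem_singleton] at hx
          rcases hx with rfl | rfl <;> simp [mem_triangle]
        · have := h (mem_triangle.2 (Or.inr rfl))
          simp [injective.eq_iff] at this
      · ext x
        simp only [triangle, Finset.mem_insert, Finset.mem_singleton]
        tauto
    -- An old face does not contain the new point, and a new face has at most three vertices.
    · rintro t ht h
      have hpt : hubChainPoint (Sum.inr (m + 1)) ∈ t := h (mem_triangle.2 (Or.inr rfl))
      rcases ht with ⟨ht, -⟩ | ⟨s, hs', rfl⟩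
      · have : hubChainPoint (Sum.inr (m + 1)) ∈ K.vertices :=
          K.down_closed ht (Finset.singleton_subset_iff.2 hpt) (Finset.singleton_nonempty _)
        rw [hv] at this
        obtain ⟨i, hi, hip⟩ := this
        have := hi _ (injective hip)
        omega
      · apply Finset.eq_of_subset_of_card_le h
        have h1 := Finset.card_lt_card hs'
        have h2 := Finset.card_insert_le (hubChainPoint (Sum.inr (m + 1))) s
        rw [card_triangle] at h1 ⊢
        omega
    · rw [Geometry.SimplicialComplex.stellarSubdivision_vertices hσ hp hw hw1 hwp
        (by rw [card_triangle]; norm_num), hv, ← Set.image_insert_eq]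
      congr 1
      ext i
      rcases i with s | k
      · simp
      · simp only [Set.mem_insert_iff, Sum.inr.injEq, Set.mem_ofPred_eq, forall_eq']
        omega
    · rw [Geometry.SimplicialComplex.stellarSubdivision_space, hs]
    · rintro i j hij (⟨h, -⟩ | ⟨s, hs', h⟩)
      · exact hadj i j hij h
      · have hpi : hubChainPoint (Sum.inr (m + 1)) ∈ ({hubChainPoint i, hubChainPoint j} :
            Finset Plane) := h ▸ Finset.mem_insert_self _ _
        have hi : hubChainPoint i ∈ insert (hubChainPoint (Sum.inr (m + 1))) s := by
          rw [← h]
          simp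
        have hj : hubChainPoint j ∈ insert (hubChainPoint (Sum.inr (m + 1))) s := by
          rw [← h]
          simp
        rw [Finset.mem_insert, injective.eq_iff] at hi hj
        simp only [Finset.mem_insert, Finset.mem_singleton, injective.eq_iff] at hpi
        rcases hpi with rfl | rfl
        · exact adj_of_mem_triangle (hs'.1 (hj.resolve_left hij.symm))
        · exact adj_symm (adj_of_mem_triangle (hs'.1 (hi.resolve_left hij)))

/-- The index set of the nested triangulation with `m` chain points. -/
def indices (m : ℕ) : Finset (Bool ⊕ ℕ) := Finset.univ.disjSum (Finset.range m)

theorem exists_triangulation (m : ℕ) :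
    ∃ T : PlaneTriangulation ((indices (m + 1)).map ⟨hubChainPoint, injective⟩),
      ∀ i j, T.graph.Adj (hubChainPoint i) (hubChainPoint j) → Adj i j := by
  obtain ⟨K, -, hv, hs, hadj⟩ := exists_complex m
  have hP : (((indices (m + 1)).map ⟨hubChainPoint, injective⟩ : Finset Plane) : Set Plane)
      = hubChainPoint '' {i | ∀ k, i = Sum.inr k → k ≤ m} := by
    rw [Finset.coe_map]
    change hubChainPoint '' _ = _
    congr 1
    ext i
    rcases i with s | k
    · simp [indices]
    · simp [indices]
  have ht : (triangle 0 : Set Plane) ⊆ hubChainPoint '' {i | ∀ k, i = Sum.inr k → k ≤ m} := by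
    intro x hx
    simp only [triangle, Finset.coe_insert, Finset.coe_singleton, Set.mem_insert_iff,
      Set.mem_singleton_iff] at hx
    rcases hx with rfl | rfl | rfl <;> exact ⟨_, by simp, rfl⟩
  refine ⟨⟨K, ?_, by rw [hP, hv], ?_⟩, ?_⟩
  · rw [hP]
    intro h
    rw [collinear_iff_of_mem (ht (by simp [triangle] :
      hubChainPoint (Sum.inl false) ∈ (triangle 0 : Set Plane)))] at h
    obtain ⟨v, hv⟩ := h
    obtain ⟨r, hr⟩ := hv (hubChainPoint (Sum.inl true)) (ht (by simp [triangle]))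
    obtain ⟨q, hq⟩ := hv (hubChainPoint (Sum.inr 0)) (ht (by simp [triangle]))
    have r0 := congrArg (fun x : Plane => x 0) hr
    have r1 := congrArg (fun x : Plane => x 1) hr
    have q1 := congrArg (fun x : Plane => x 1) hq
    simp at r0 r1 q1
    rcases r1 with r1 | r1
    · rw [r1] at r0
      norm_num at r0
    · rw [r1] at q1
      norm_num at q1
  · rw [hP, hs]
    apply Set.Subset.antisymm (convexHull_mono ht)
    apply convexHull_min _ (convex_convexHull ℝ _)
    rw [← hv, ← hs]
    exact K.vertices_subset_space
  · rintro i j ⟨hij, h⟩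
    exact hadj i j (fun e => hij (congrArg _ e)) (by convert h)

end hubChainPoint

/-! ### Lists of consecutive integers, and splitting at a hub. -/

namespace List

/-- A list of naturals in which neighbours differ by one and which never repeats an entry is an
interval, traversed upwards or downwards. -/
theorem exists_eq_range'_of_isChain {l : List ℕ} (h : l.IsChain fun i j => j = i + 1 ∨ i = j + 1)
    (hn : l.Nodup) : ∃ i k, l = range' i k ∨ l = (range' i k).reverse := by
  induction l with
  | nil => exact ⟨0, 0, by simp⟩
  | cons x l ih =>
    rcases l with _ | ⟨y, t⟩
    · exact ⟨x, 1, by simp⟩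
    · rw [isChain_cons_cons] at h
      obtain ⟨i, k, hk⟩ := ih h.2 (nodup_cons.1 hn).2
      have hlen : k = t.length + 1 := by
        rcases hk with hk | hk <;> simpa using (congrArg length hk).symm
      have hx : x ∉ y :: t := (nodup_cons.1 hn).1
      rcases hk with hk | hk
      · have hiy : y = i := by
          rw [hlen, range'_succ] at hk
          exact (cons.inj hk).1
        subst hiy
        rcases h.1 with e | e
        · subst e
          exact ⟨x, k + 1, Or.inl (by rw [hk, range'_succ])⟩
        · subst e
          rcases t with _ | ⟨z, t⟩
          · exact ⟨y, 2, Or.inr (by simp [range'_succ])⟩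
          · refine absurd ?_ hx
            rw [hk, mem_range'_1, hlen]
            simp
      · have hiy : i + t.length = y := by
          rw [hlen, range'_concat] at hk
          simpa using (congrArg head? hk).symm
        rcases h.1 with e | e
        · rcases t with _ | ⟨z, t⟩
          · exact ⟨x, 2, Or.inl (by simp [range'_succ, e])⟩
          · refine absurd ?_ hx
            rw [hk, mem_reverse, mem_range'_1, hlen]
            simp at hiy ⊢
            omega
        · refine ⟨i, k + 1, Or.inr ?_⟩
          rw [range'_concat, reverse_append, ← hk, reverse_singleton]
          simp only [singleton_append, cons.injEq, and_true]
          omega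

/-- The part of a list of a sum type before the first left entry. -/
theorem exists_eq_map_inr_append {α β : Type*} (l : List (α ⊕ β)) :
    ∃ X : List β, l = X.map Sum.inr ∨ ∃ s r, l = X.map Sum.inr ++ Sum.inl s :: r := by
  induction l with
  | nil => exact ⟨[], Or.inl rfl⟩
  | cons x l ih =>
    rcases x with s | k
    · exact ⟨[], Or.inr ⟨s, l, rfl⟩⟩
    · obtain ⟨X, h | ⟨s, r, h⟩⟩ := ih
      · exact ⟨k :: X, Or.inl (by rw [h]; rfl)⟩
      · exact ⟨k :: X, Or.inr ⟨s, r, by rw [h]; rfl⟩⟩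

end List

/-! ### Runs along the chain. -/

namespace hubChainPoint

open List

/-- A step of a path of the nested triangulation that raises the height `f`. -/
def Step (f : Bool ⊕ ℕ → ℝ) (i j : Bool ⊕ ℕ) : Prop := Adj i j ∧ f i < f j

theorem pairwise_of_isChain_step {f : Bool ⊕ ℕ → ℝ} {l : List (Bool ⊕ ℕ)}
    (h : l.IsChain (Step f)) : l.Pairwise fun i j => f i < f j := by
  have : Trans (fun i j => f i < f j) (fun i j => f i < f j) (fun i j => f i < f j) :=
    ⟨fun h h' => lt_trans h h'⟩
  exact isChain_iff_pairwise.1 (h.imp fun _ _ h => h.2)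

/-- The upward and downward traversals of chain intervals that have lowest index below `n` and fewer
than `k` points. -/
def runs (n k : ℕ) : Finset (List ℕ) :=
  (Finset.range n ×ˢ Finset.range k).image (fun x => range' x.1 x.2) ∪
  (Finset.range n ×ˢ Finset.range k).image (fun x => (range' x.1 x.2).reverse)

theorem card_runs_le (n k : ℕ) : (runs n k).card ≤ 2 * (n * k) := by
  refine (Finset.card_union_le _ _).trans ?_
  have h1 := Finset.card_image_le (s := Finset.range n ×ˢ Finset.range k)
    (f := fun x => range' x.1 x.2)
  have h2 := Finset.card_image_le (s := Finset.range n ×ˢ Finset.range k)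
    (f := fun x => (range' x.1 x.2).reverse)
  rw [Finset.card_product, Finset.card_range, Finset.card_range] at h1 h2
  omega

theorem range'_mem_runs {i k n N : ℕ} (h : ∀ j ∈ range' i k, j + 1 < n) (hn : 0 < n)
    (hk : k < N) : range' i k ∈ runs n N ∧ (range' i k).reverse ∈ runs n N := by
  -- For an empty run `i` is unconstrained, so it is represented with start `0`.
  rcases k with _ | k
  · exact ⟨Finset.mem_union_left _ (Finset.mem_image.2 ⟨(0, 0), by simp [hn, hk], by simp⟩),
      Finset.mem_union_left _ (Finset.mem_image.2 ⟨(0, 0), by simp [hn, hk], by simp⟩)⟩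
  · have hi := h i (by simp)
    have : (i, k + 1) ∈ Finset.range n ×ˢ Finset.range N := by
      simp only [Finset.mem_product, Finset.mem_range]
      omega
    exact ⟨Finset.mem_union_left _ (Finset.mem_image.2 ⟨_, this, rfl⟩),
      Finset.mem_union_right _ (Finset.mem_image.2 ⟨_, this, rfl⟩)⟩

/-- Increasing `f` excludes repetitions, hence turning back. The threshold `4` is the number of
points that `height_hub_le` and `le_height_hub` involve. -/
theorem run_cases {f : Bool ⊕ ℕ → ℝ} {X : List ℕ} {n : ℕ} (hn : 0 < n)
    (h : (X.map Sum.inr).IsChain (Step f)) (hX : ∀ i ∈ X, i + 1 < n) :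
    X ∈ runs n n ∧ (X ∈ runs n 4 ∨
      ∃ i k, 4 ≤ k ∧ (X = range' i k ∨ X = (range' i k).reverse)) := by
  have hp := pairwise_of_isChain_step h
  have hnd : X.Nodup := by
    rw [pairwise_map] at hp
    exact hp.imp fun {a b} hab => by rintro rfl; exact lt_irrefl _ hab
  have hc : X.IsChain fun i j => j = i + 1 ∨ i = j + 1 :=
    ((isChain_map _).1 h).imp fun _ _ h => h.1
  obtain ⟨i, k, hk⟩ := exists_eq_range'_of_isChain hc hnd
  have hj : ∀ j ∈ range' i k, j + 1 < n := by
    intro j hj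
    apply hX
    rcases hk with rfl | rfl
    · exact hj
    · exact mem_reverse.2 hj
  have hkn : k < n := by
    rcases k with _ | k
    · exact hn
    · have := hj (i + k) (by simp)
      omega
  constructor
  · rcases hk with rfl | rfl
    exacts [(range'_mem_runs hj hn hkn).1, (range'_mem_runs hj hn hkn).2]
  · rcases lt_or_ge k 4 with h4 | h4
    · left
      rcases hk with rfl | rfl
      exacts [(range'_mem_runs hj hn h4).1, (range'_mem_runs hj hn h4).2]
    · exact Or.inr ⟨i, k, h4, hk⟩

/-! ### Constraints on the direction imposed by long runs. -/

section height

variable (u : Plane)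

/-- The height of a point of the configuration in direction `u`. -/
noncomputable def height (i : Bool ⊕ ℕ) : ℝ := inner ℝ (hubChainPoint i) u

theorem height_inl (s : Bool) : height u (Sum.inl s) = (if s then 3 else -3) * u 0 := by
  simp [height, PiLp.inner_apply, Fin.sum_univ_two, mul_comm]

theorem height_inr (k : ℕ) : height u (Sum.inr k) = (-1) ^ k * u 0 + (1 / 4) ^ k * u 1 := by
  simp [height, PiLp.inner_apply, Fin.sum_univ_two, mul_comm]

variable {u}

/-- Chain points `i` and `i + 2` have the same first coordinate, so their heights differ only by a
multiple of `u 1`. -/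
theorem neg_of_height_lt_height {i : ℕ} (h1 : height u (Sum.inr i) < height u (Sum.inr (i + 1)))
    (h2 : height u (Sum.inr (i + 1)) < height u (Sum.inr (i + 2))) : u 1 < 0 := by
  simp only [height_inr, pow_succ] at h1 h2
  have hy : (0 : ℝ) < (1 / 4) ^ i := by positivity
  by_contra! h
  have := mul_nonneg hy.le h
  rcases neg_one_pow_eq_or ℝ i with e | e <;> rw [e] at h1 h2 <;> linarith

theorem pos_of_height_lt_height {i : ℕ}
    (h1 : height u (Sum.inr (i + 2)) < height u (Sum.inr (i + 1)))
    (h2 : height u (Sum.inr (i + 1)) < height u (Sum.inr i)) : 0 < u 1 := by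
  simp only [height_inr, pow_succ] at h1 h2
  have hy : (0 : ℝ) < (1 / 4) ^ i := by positivity
  by_contra! h
  have := mul_nonneg hy.le (neg_nonneg.2 h)
  rcases neg_one_pow_eq_or ℝ i with e | e <;> rw [e] at h1 h2 <;> linarith

/-- Ascending two chain edges and then, possibly after another edge, moving on to a hub is not
monotone. -/
theorem height_hub_le {i : ℕ} (s : Bool)
    (h1 : height u (Sum.inr (i + 3)) < height u (Sum.inr (i + 2)))
    (h2 : height u (Sum.inr (i + 2)) < height u (Sum.inr (i + 1))) :
    height u (Sum.inl s) ≤ height u (Sum.inr i) := by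
  simp only [height_inr, pow_succ] at h1 h2
  rw [height_inl, height_inr]
  have hy : (0 : ℝ) < (1 / 4) ^ i := by positivity
  -- Put `y = (1 / 4) ^ i * u 1`. Together `h1` and `h2` give `0 < y`, and separately they give `|u
  -- 0| < 3 * y / 32`. So a hub has height at most `3 * |u 0| < y - |u 0|`, which is at most the
  -- height of chain point `i`.
  have hu : 0 < u 1 := by
    by_contra! h
    have := mul_nonneg hy.le (neg_nonneg.2 h)
    rcases neg_one_pow_eq_or ℝ i with e | e <;> rw [e] at h1 h2 <;> linarith
  have := mul_pos hy hu
  rcases neg_one_pow_eq_or ℝ i with e | e <;> rw [e] at h1 h2 ⊢ <;> cases s <;>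
    simp only [Bool.false_eq_true, if_false, if_true] <;> linarith

/-- This is `height_hub_le` for the direction `-u`. -/
theorem le_height_hub {i : ℕ} (s : Bool)
    (h1 : height u (Sum.inr (i + 2)) < height u (Sum.inr (i + 3)))
    (h2 : height u (Sum.inr (i + 1)) < height u (Sum.inr (i + 2))) :
    height u (Sum.inr i) ≤ height u (Sum.inl s) := by
  simp only [height_inr, pow_succ] at h1 h2
  rw [height_inl, height_inr]
  have hy : (0 : ℝ) < (1 / 4) ^ i := by positivity
  have hu : u 1 < 0 := by
    by_contra! h
    have := mul_nonneg hy.le h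
    rcases neg_one_pow_eq_or ℝ i with e | e <;> rw [e] at h1 h2 <;> linarith
  have := mul_neg_of_pos_of_neg hy hu
  rcases neg_one_pow_eq_or ℝ i with e | e <;> rw [e] at h1 h2 ⊢ <;> cases s <;>
    simp only [Bool.false_eq_true, if_false, if_true] <;> linarith

/-- A chain point below one hub and a chain point above the other hub, which is higher than the
first one, cannot coexist. -/
theorem not_height_lt_hubs {s t : Bool} (hst : height u (Sum.inl s) < height u (Sum.inl t))
    {i j : ℕ} (hi : height u (Sum.inr i) < height u (Sum.inl s))
    (hj : height u (Sum.inl t) < height u (Sum.inr j)) : False := by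
  rw [height_inl] at hst hi hj
  rw [height_inl] at hst
  rw [height_inr] at hi hj
  have hyi : (0 : ℝ) < (1 / 4) ^ i := by positivity
  have hyj : (0 : ℝ) < (1 / 4) ^ j := by positivity
  -- The hubs have heights `±3 * |u 0|` with `u 0 ≠ 0`. If `0 ≤ u 1`, every chain point has height
  -- at least `-|u 0|`, above the lower hub; if `u 1 ≤ 0`, every one is below the upper hub.
  rcases le_total 0 (u 1) with h | h
  · have := mul_nonneg hyi.le h
    rcases neg_one_pow_eq_or ℝ i with e | e <;> rw [e] at hi <;> cases s <;> cases t <;>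
      simp only [Bool.false_eq_true, if_false, if_true] at hst hi hj <;> linarith
  · have := mul_nonneg hyj.le (neg_nonneg.2 h)
    rcases neg_one_pow_eq_or ℝ j with e | e <;> rw [e] at hj <;> cases s <;> cases t <;>
      simp only [Bool.false_eq_true, if_false, if_true] at hst hi hj <;> linarith

theorem height_lt_of_pairwise_range' {i k : ℕ}
    (h : ((range' i k).map Sum.inr).Pairwise fun a b => height u a < height u b) {a : ℕ}
    (ha : a + 1 < k) : height u (Sum.inr (i + a)) < height u (Sum.inr (i + a + 1)) := by
  have hl : (range' i k).length = k := length_range'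
  have h' := pairwise_iff_getElem.1 (pairwise_map.1 h) a (a + 1) (by rw [hl]; omega)
    (by rwa [hl]) (Nat.lt_succ_self a)
  simpa only [getElem_range', one_mul, ← add_assoc] using h'

theorem height_lt_of_pairwise_reverse_range' {i k : ℕ}
    (h : ((range' i k).reverse.map Sum.inr).Pairwise fun a b => height u a < height u b) {a : ℕ}
    (ha : a + 1 < k) : height u (Sum.inr (i + a + 1)) < height u (Sum.inr (i + a)) := by
  have hl : (range' i k).length = k := length_range'
  have h' := pairwise_iff_getElem.1 (pairwise_reverse.1 (pairwise_map.1 h)) a (a + 1)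
    (by rw [hl]; omega) (by rwa [hl]) (Nat.lt_succ_self a)
  simpa only [getElem_range', one_mul, ← add_assoc] using h'

/-- A long run leading into a hub descends along the chain. -/
theorem neg_or_mem_runs_of_before_hub {X : List ℕ} {n : ℕ} (hn : 0 < n)
    (h : (X.map Sum.inr).IsChain (Step (height u))) (hX : ∀ i ∈ X, i + 1 < n) {s : Bool}
    (hs : ∀ i ∈ X, height u (Sum.inr i) < height u (Sum.inl s)) :
    X ∈ runs n 4 ∨ u 1 < 0 := by
  have hp := pairwise_of_isChain_step h
  rcases (run_cases hn h hX).2 with h | ⟨i, k, hk, rfl | rfl⟩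
  · exact Or.inl h
  · exact Or.inr (neg_of_height_lt_height (height_lt_of_pairwise_range' hp (a := 0) (by omega))
      (height_lt_of_pairwise_range' hp (a := 1) (by omega)))
  -- A run with decreasing indices ends at `i`, which is already at least as high as the hub.
  · refine absurd (hs i ?_) (not_lt.2 (height_hub_le s
      (height_lt_of_pairwise_reverse_range' hp (a := 2) (by omega))
      (height_lt_of_pairwise_reverse_range' hp (a := 1) (by omega))))
    rw [mem_reverse, mem_range'_1]
    omega

/-- A long run leading out of a hub ascends along the chain. -/
theorem pos_or_mem_runs_of_after_hub {X : List ℕ} {n : ℕ} (hn : 0 < n)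
    (h : (X.map Sum.inr).IsChain (Step (height u))) (hX : ∀ i ∈ X, i + 1 < n) {s : Bool}
    (hs : ∀ i ∈ X, height u (Sum.inl s) < height u (Sum.inr i)) :
    X ∈ runs n 4 ∨ 0 < u 1 := by
  have hp := pairwise_of_isChain_step h
  rcases (run_cases hn h hX).2 with h | ⟨i, k, hk, rfl | rfl⟩
  · exact Or.inl h
  · refine absurd (hs i ?_) (not_lt.2 (le_height_hub s
      (height_lt_of_pairwise_range' hp (a := 2) (by omega))
      (height_lt_of_pairwise_range' hp (a := 1) (by omega))))
    rw [mem_range'_1]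
    omega
  · exact Or.inr (pos_of_height_lt_height
      (height_lt_of_pairwise_reverse_range' hp (a := 1) (by omega))
      (height_lt_of_pairwise_reverse_range' hp (a := 0) (by omega)))

end height

/-! ### Counting the monotone paths. -/

/-- Pairs of runs of which at least one is short. -/
def runPairs (n : ℕ) : Finset (List ℕ × List ℕ) := runs n n ×ˢ runs n 4 ∪ runs n 4 ×ˢ runs n n

theorem card_runPairs_le (n : ℕ) : (runPairs n).card ≤ 32 * n ^ 3 := by
  refine (Finset.card_union_le _ _).trans ?_
  rw [Finset.card_product, Finset.card_product]
  have := Nat.mul_le_mul (card_runs_le n n) (card_runs_le n 4)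
  calc _ = 2 * ((runs n n).card * (runs n 4).card) := by ring
    _ ≤ 2 * (2 * (n * n) * (2 * (n * 4))) := Nat.mul_le_mul_left 2 this
    _ = 32 * n ^ 3 := by ring

/-- A finite set containing all monotone paths of the nested triangulation. -/
def paths (n : ℕ) : Finset (List (Bool ⊕ ℕ)) :=
  (runs n n).image (fun X => X.map Sum.inr) ∪
  (Finset.univ ×ˢ runPairs n).image
    (fun x : Bool × List ℕ × List ℕ => x.2.1.map Sum.inr ++ Sum.inl x.1 :: x.2.2.map Sum.inr) ∪
  (Finset.univ ×ˢ runPairs n).image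
    (fun x : Bool × List ℕ × List ℕ => x.2.1.map Sum.inr ++ Sum.inl x.1 :: (x.2.2.map Sum.inr ++
      [Sum.inl (!x.1)])) ∪
  (Finset.univ ×ˢ runPairs n).image
    (fun x : Bool × List ℕ × List ℕ => Sum.inl x.1 :: (x.2.1.map Sum.inr ++
      Sum.inl (!x.1) :: x.2.2.map Sum.inr))

/-- The constant is `2 + 3 * 64`: paths without hubs, and three families of a hub with a pair of
runs. -/
theorem card_paths_le {n : ℕ} (hn : 0 < n) : (paths n).card ≤ 194 * n ^ 3 := by
  have h1 := (Finset.card_image_le (s := runs n n)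
    (f := fun X => X.map (Sum.inr : ℕ → Bool ⊕ ℕ))).trans (card_runs_le n n)
  have h2 : ∀ f : Bool × List ℕ × List ℕ → List (Bool ⊕ ℕ),
      ((Finset.univ ×ˢ runPairs n).image f).card ≤ 64 * n ^ 3 := by
    intro f
    refine Finset.card_image_le.trans ?_
    rw [Finset.card_product, Finset.card_univ, Fintype.card_bool]
    have := card_runPairs_le n
    omega
  have h3 : n * n ≤ n ^ 3 := by
    calc n * n = n ^ 2 := (sq n).symm
      _ ≤ n ^ 3 := Nat.pow_le_pow_right hn (by norm_num)
  refine (Finset.card_union_le _ _).trans ?_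
  refine (Nat.add_le_add_right (Finset.card_union_le _ _) _).trans ?_
  refine (Nat.add_le_add_right (Nat.add_le_add_right (Finset.card_union_le _ _) _) _).trans ?_
  refine (Nat.add_le_add (Nat.add_le_add (Nat.add_le_add h1 (h2 _)) (h2 _)) (h2 _)).trans ?_
  omega

theorem mem_paths_of_isChain {u : Plane} {l : List (Bool ⊕ ℕ)} {n : ℕ} (hn : 0 < n)
    (h : l.IsChain (Step (height u))) (hl : ∀ k, Sum.inr k ∈ l → k + 1 < n) : l ∈ paths n := by
  have hp := pairwise_of_isChain_step h
  obtain ⟨X, rfl | ⟨s, r, rfl⟩⟩ := exists_eq_map_inr_append l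
  · refine Finset.mem_union_left _ (Finset.mem_union_left _ (Finset.mem_union_left _ ?_))
    exact Finset.mem_image_of_mem _ (run_cases hn h fun i hi => hl i (by simpa using hi)).1
  have hX : ∀ i ∈ X, i + 1 < n := fun i hi => hl i (by simp [hi])
  have hXc := (isChain_append.1 h).1
  have hrc : r.IsChain (Step (height u)) := (isChain_append.1 h).2.1.tail
  rw [pairwise_append, pairwise_cons] at hp
  obtain ⟨-, ⟨hsr, hpr⟩, hXr⟩ := hp
  have hXs : ∀ i ∈ X, height u (Sum.inr i) < height u (Sum.inl s) := fun i hi =>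
    hXr _ (mem_map_of_mem hi) _ (by simp)
  have hXR := (run_cases hn hXc hX).1
  obtain ⟨Y, rfl | ⟨t, r, rfl⟩⟩ := exists_eq_map_inr_append r
  · have hY : ∀ i ∈ Y, i + 1 < n := fun i hi => hl i (by simp [hi])
    have hYR := (run_cases hn hrc hY).1
    refine Finset.mem_union_left _ (Finset.mem_union_left _ (Finset.mem_union_right _ ?_))
    refine Finset.mem_image.2 ⟨(s, X, Y), Finset.mem_product.2 ⟨Finset.mem_univ _, ?_⟩, rfl⟩
    rcases neg_or_mem_runs_of_before_hub hn hXc hX hXs with hXS | hneg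
    · exact Finset.mem_union_right _ (Finset.mem_product.2 ⟨hXS, hYR⟩)
    · rcases pos_or_mem_runs_of_after_hub hn hrc hY
        (fun i hi => hsr _ (mem_map_of_mem hi)) with hYS | hpos
      · exact Finset.mem_union_left _ (Finset.mem_product.2 ⟨hXR, hYS⟩)
      · exact absurd hneg hpos.le.not_gt
  have hst : height u (Sum.inl s) < height u (Sum.inl t) := hsr _ (by simp)
  obtain rfl : t = !s := by
    rw [Bool.eq_not]
    rintro rfl
    exact lt_irrefl _ hst
  have hY : ∀ i ∈ Y, i + 1 < n := fun i hi => hl i (by simp [hi])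
  have hYc := (isChain_append.1 hrc).1
  rw [pairwise_append, pairwise_cons] at hpr
  obtain ⟨-, ⟨htr, -⟩, hYr⟩ := hpr
  -- The middle run both leaves a hub and enters one; if long, it would force both signs of `u 1`.
  have hYS : Y ∈ runs n 4 := by
    rcases neg_or_mem_runs_of_before_hub hn hYc hY
      (s := !s) (fun i hi => hYr _ (mem_map_of_mem hi) _ (by simp)) with hYS | hneg
    · exact hYS
    · rcases pos_or_mem_runs_of_after_hub hn hYc hY (s := s)
        (fun i hi => hsr _ (by simp [hi])) with hYS | hpos
      · exact hYS
      · exact absurd hneg hpos.le.not_gt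
  obtain ⟨Z, rfl | ⟨q, r, rfl⟩⟩ := exists_eq_map_inr_append r
  · have hZ : ∀ i ∈ Z, i + 1 < n := fun i hi => hl i (by simp [hi])
    have hZR := (run_cases hn (isChain_append.1 hrc).2.1.tail hZ).1
    -- One outer run is empty, so the short run `Y` is paired with the other.
    rcases Z with _ | ⟨z, Z⟩
    · refine Finset.mem_union_left _ (Finset.mem_union_right _ ?_)
      exact Finset.mem_image.2 ⟨(s, X, Y), Finset.mem_product.2 ⟨Finset.mem_univ _,
        Finset.mem_union_left _ (Finset.mem_product.2 ⟨hXR, hYS⟩)⟩, rfl⟩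
    · rcases X with _ | ⟨x, X⟩
      · refine Finset.mem_union_right _ ?_
        exact Finset.mem_image.2 ⟨(s, Y, z :: Z), Finset.mem_product.2 ⟨Finset.mem_univ _,
          Finset.mem_union_right _ (Finset.mem_product.2 ⟨hYS, hZR⟩)⟩, rfl⟩
      · exact (not_height_lt_hubs hst (hXs x (by simp)) (htr (Sum.inr z) (by simp))).elim
  · have h1 : height u (Sum.inl s) < height u (Sum.inl q) := hsr _ (by simp)
    have h2 : height u (Sum.inl (!s)) < height u (Sum.inl q) := htr _ (by simp)
    cases s <;> cases q <;> simp at h1 h2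

end hubChainPoint

namespace hubChainPoint

/-- The argument `m + 2` is the number of points: `m` chain points and two hubs. -/
theorem monotonePaths_subset {m : ℕ}
    {T : PlaneTriangulation ((indices m).map ⟨hubChainPoint, injective⟩)}
    (hT : ∀ i j, T.graph.Adj (hubChainPoint i) (hubChainPoint j) → Adj i j) :
    T.monotonePaths ⊆ ((paths (m + 2)).image (List.map hubChainPoint) : Finset (List Plane)) := by
  rintro l ⟨⟨-, hP, hc⟩, u, -, hu⟩
  obtain ⟨l, rfl⟩ : ∃ l', List.map hubChainPoint l' = l := by
    rw [← Set.mem_range, Set.range_list_map]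
    intro p hp
    obtain ⟨i, -, hi⟩ := Finset.mem_map.1 (hP p hp)
    exact ⟨i, hi⟩
  rw [Finset.mem_coe]
  refine Finset.mem_image_of_mem _ (mem_paths_of_isChain (u := u) (by omega) ?_ ?_)
  · unfold IsMonotoneInDirection at hu
    rw [List.isChain_map] at hc hu
    rw [List.isChain_iff_getElem] at hc hu ⊢
    intro i hi
    refine ⟨hT _ _ (hc i hi), ?_⟩
    have := hu i hi
    rwa [inner_sub_left, sub_pos] at this
  · intro k hk
    obtain ⟨i, hi, hik⟩ := Finset.mem_map.1 (hP _ (List.mem_map_of_mem hk))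
    obtain rfl := injective hik
    have : k < m := by simpa [indices] using hi
    omega

theorem card_indices (m : ℕ) : (indices m).card = m + 2 := by
  simp [indices, Finset.card_disjSum, add_comm]

end hubChainPoint

theorem exists_triangulation_ncard_monotonePaths_le {n : ℕ} (hn : 3 ≤ n) :
    ∃ (P : Finset Plane) (T : PlaneTriangulation P), P.card = n ∧ T.monotonePaths.Finite ∧
      T.monotonePaths.ncard ≤ 194 * n ^ 3 := by
  obtain ⟨m, rfl⟩ := Nat.exists_eq_add_of_le' hn
  obtain ⟨T, hT⟩ := hubChainPoint.exists_triangulation m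
  have hsub := hubChainPoint.monotonePaths_subset hT
  refine ⟨_, T, ?_, (Finset.finite_toSet _).subset hsub, ?_⟩
  · rw [Finset.card_map, hubChainPoint.card_indices]
  · refine (Set.ncard_le_ncard hsub (Finset.finite_toSet _)).trans ?_
    rw [Set.ncard_coe_finset]
    exact Finset.card_image_le.trans (hubChainPoint.card_paths_le (by omega))

/-! ### Comparison of exponents and the final bound. -/

theorem three_le_two_mul_logb_two_three : 3 ≤ 2 * Real.logb 2 3 := by
  rw [show (2 : ℝ) * Real.logb 2 3 = ((2 : ℕ) : ℝ) * Real.logb 2 3 by norm_num, ← Real.logb_pow,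
    Real.le_logb_iff_rpow_le (by norm_num) (by positivity),
    show (3 : ℝ) = ((3 : ℕ) : ℝ) by norm_num, Real.rpow_natCast]
  norm_num

/-- Equivalent to `3 ^ 200 < 2 ^ 317`. -/
theorem two_mul_logb_two_three_lt : 2 * Real.logb 2 3 < 3.17 := by
  have h : (200 : ℝ) * Real.logb 2 3 < 317 := by
    rw [show (200 : ℝ) = ((200 : ℕ) : ℝ) by norm_num, ← Real.logb_pow,
      Real.logb_lt_iff_lt_rpow (by norm_num) (by positivity),
      show (317 : ℝ) = ((317 : ℕ) : ℝ) by norm_num, Real.rpow_natCast,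
      show 317 = 200 + 117 by norm_num, pow_add]
    norm_num
  linarith

/-- The logarithm is `O(x ^ ((b - a) / 2))`, and squaring uses up the gap `b - a`. -/
theorem isBigO_rpow_mul_logb_sq {a b : ℝ} (h : a < b) :
    (fun n : ℕ => (n : ℝ) ^ a * (Real.logb 2 (n : ℝ)) ^ 2)
      =O[Filter.atTop] (fun n : ℕ => (n : ℝ) ^ b) := by
  have hlog : (fun x : ℝ => Real.logb 2 x) =O[Filter.atTop] fun x => x ^ ((b - a) / 2) := by
    simp only [Real.logb, div_eq_inv_mul]
    exact (isLittleO_log_rpow_atTop (by linarith)).isBigO.const_mul_left _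
  have h2 := (Asymptotics.isBigO_refl (fun x : ℝ => x ^ a) Filter.atTop).mul (hlog.pow 2)
  have h3 : (fun x : ℝ => x ^ a * (x ^ ((b - a) / 2)) ^ 2) =ᶠ[Filter.atTop] fun x => x ^ b := by
    filter_upwards [Filter.eventually_gt_atTop 0] with x hx
    rw [← Real.rpow_natCast, ← Real.rpow_mul hx.le, ← Real.rpow_add hx]
    congr 1
    push_cast
    ring
  exact (h2.trans_eventuallyEq h3).comp_tendsto tendsto_natCast_atTop_atTop

theorem theorem3 :
    (∃ C : ℝ, ∀ n : ℕ, 3 ≤ n →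
      ∃ (P : Finset Plane) (T : PlaneTriangulation P),
        P.card = n ∧
        T.monotonePaths.Finite ∧
        (T.monotonePaths.ncard : ℝ) ≤
          C * ((n : ℝ) ^ (2 * Real.logb 2 3) * (Real.logb 2 (n : ℝ)) ^ 2)) ∧
    (fun n : ℕ => (n : ℝ) ^ (2 * Real.logb 2 3) * (Real.logb 2 (n : ℝ)) ^ 2)
      =O[Filter.atTop] (fun n : ℕ => (n : ℝ) ^ (3.17 : ℝ)) := by
  refine ⟨⟨194, fun n hn => ?_⟩, isBigO_rpow_mul_logb_sq two_mul_logb_two_three_lt⟩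
  obtain ⟨P, T, hP, hfin, hcard⟩ := exists_triangulation_ncard_monotonePaths_le hn
  refine ⟨P, T, hP, hfin, ?_⟩
  have hn' : (3 : ℝ) ≤ n := by exact_mod_cast hn
  have h1 : (n : ℝ) ^ 3 ≤ (n : ℝ) ^ (2 * Real.logb 2 3) := by
    rw [← Real.rpow_natCast]
    exact Real.rpow_le_rpow_of_exponent_le (by linarith)
      (by exact_mod_cast three_le_two_mul_logb_two_three)
  -- The cubic bound needs no logarithm; the factor is harmless because `2 ≤ n`.
  have h2 : 1 ≤ Real.logb 2 (n : ℝ) ^ 2 := by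
    apply one_le_pow₀
    rw [Real.le_logb_iff_rpow_le (by norm_num) (by linarith), Real.rpow_one]
    linarith
  calc (T.monotonePaths.ncard : ℝ) ≤ 194 * (n : ℝ) ^ 3 := by exact_mod_cast hcard
    _ ≤ 194 * ((n : ℝ) ^ (2 * Real.logb 2 3) * (Real.logb 2 (n : ℝ)) ^ 2) := by
        gcongr
        exact h1.trans (le_mul_of_one_le_right (by positivity) h2)
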